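/- For $\lambda\ge 0$ let $$q_3(\lambda)=\sup_{x>0}\frac{3!}{x^3}\left|e^{ix}-\sum_{k=0}^{2}\frac{(ix)^k}{k!}-\lambda\frac{(ix)^3}{3!}\right|,\qquad \varkappa_3=\sup_{x>0}\frac{\cos x-1+x^2/2}{x^3}.$$ The equation $x^2+2x\sin x+6(\cos x-1)=0$ has a unique root $\theta_3^*=3.9958\ldots$ in $(0,2\pi)$; put $$\lambda^*=6\,\frac{\theta_3^*-\sin\theta_3^*}{(\theta_3^*)^3}=0.4466\ldots.$$ For $3/8<\lambda\le\lambda^*$ the equation $$2\cos x\,(\lambda x^4-18x^2+36)-6x\sin x\,(x^2(\lambda+1)-12)-(3-4\lambda)x^4-72=0$$ has a unique root in $(0,2\pi)$, denoted by $\theta_3(\lambda)$; put $\theta_3(\lambda)=0$ for $0\le\lambda\le 3/8$. Then: - $q_3(\lambda)$ is finite for every $\lambda\ge0$, and $\theta_3(\lambda^*)=\theta_3^*$; - $q_3(\lambda)=1-\lambda$ for $0\le\lambda\le 3/8$; - for $3/8<\lambda\le\lambda^*$ the supremum defining $q_3(\lambda)$ is attained at $x=\theta_3(\lambda)$, and $$q_3(\lambda)=\frac6{x^3}\sqrt{\Big(\cos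 x-1+\frac{x^2}2\Big)^2+\Big(\sin x-x+\frac{\lambda x^3}6\Big)^2}\;\bigg|_{x=\theta_3(\lambda)};$$ - $\lambda+q_3(\lambda)$ is strictly increasing on $3/8<\lambda\le\lambda^*$, and $q_3(\lambda)$ is strictly decreasing on $0\le\lambda\le\lambda^*$; - $q_3(3/8)=5/8$, and $\inf_{\lambda\ge0}q_3(\lambda)=q_3(\lambda^*)=6\varkappa_3=0.594971\ldots$ (so the infimum is attained at $\lambda^*$). A decimal followed by dots gives the leading digits of the number (truncated, not rounded). -/

import Mathlib

/-- The quotient `(n! / x ^ n) * |e^{ix} - ∑_{k < n} (ix)^k / k! - l (ix)^n / n!|`,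
meant for `x > 0`. -/
noncomputable def expTaylorRatio (n : ℕ) (l x : ℝ) : ℝ :=
  (n.factorial : ℝ) / x ^ n *
    ‖Complex.exp (Complex.I * (x : ℂ))
      - ∑ k ∈ Finset.range n, (Complex.I * (x : ℂ)) ^ k / (k.factorial : ℂ)
      - (l : ℂ) * ((Complex.I * (x : ℂ)) ^ n / (n.factorial : ℂ))‖

/-- The function `q_n(l)`, the supremum over `x > 0` of the quotient above. -/
noncomputable def expTaylorQ (n : ℕ) (l : ℝ) : ℝ :=
  sSup (expTaylorRatio n l '' Set.Ioi 0)

/-- The constant `ϰ₃ = sup_{x > 0} (cos x - 1 + x² / 2) / x³`. -/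
noncomputable def kappaThree : ℝ :=
  sSup ((fun x : ℝ => (Real.cos x - 1 + x ^ 2 / 2) / x ^ 3) '' Set.Ioi 0)

/-- `x` is a root in `(0, 2π)` of the equation `x² + 2 x sin x + 6 (cos x - 1) = 0`. -/
def IsThetaStarRoot (x : ℝ) : Prop :=
  x ∈ Set.Ioo 0 (2 * Real.pi) ∧
    x ^ 2 + 2 * x * Real.sin x + 6 * (Real.cos x - 1) = 0

/-- `x` is a root in `(0, 2π)` of the trigonometric equation with parameter `l`
that locates the maximum of `expTaylorRatio 3 l`. -/
def IsThetaRoot (l x : ℝ) : Prop :=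
  x ∈ Set.Ioo 0 (2 * Real.pi) ∧
    2 * Real.cos x * (l * x ^ 4 - 18 * x ^ 2 + 36)
      - 6 * x * Real.sin x * (x ^ 2 * (l + 1) - 12)
      - (3 - 4 * l) * x ^ 4 - 72 = 0

open Set Filter Topology

/-! Put F(x) = 6 (e^{ix} - 1 - ix + x²/2) / (ix)³ = B(x) + i A(x). The quotient defining q₃(l) is
|F(x) - l|, so q₃(l) is the largest distance from the real point l to the curve F.

The derivative of |F(x) - l|² is a positive multiple of l - `critParam x`, and on (0, 2π)
`critParam` increases strictly from its limit 3/8 at 0+. Hence on (0, 2π) the distance decreases if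
l ≤ 3/8, with limit |1 - l| at 0, and otherwise peaks at the solution of `critParam x = l`, when
there is one. For 0 ≤ l ≤ 0.4467 the range x ≥ 2π is beaten by the value at π (`ratioSq_le_at_pi`).
For l ≤ 3/8 the triangle inequality through the point 3/8 gives q₃(l) ≤ 1 - l.

At θ₃* the derivative of A vanishes, so `critParam` equals B there, and with λ* = B(θ₃*) the
farthest point of the curve lies straight above λ*: q₃(λ*) = A(θ₃*). For every l, q₃(l) ≥ |F(θ₃*) -
l| ≥ A(θ₃*), strictly if l ≠ λ*; this gives the minimum. Also A(x) ≤ |F(x) - λ*| ≤ A(θ₃*), so the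
value is 6ϰ₃. Convexity of q₃ gives strict decrease up to λ*. -/

/-! ### Monotone l'Hôpital rule -/

theorem pos_of_hasDerivAt_pos {g g' : ℝ → ℝ} {b : ℝ} (hg : ∀ x, HasDerivAt g (g' x) x)
    (hg0 : g 0 = 0) (hpos : ∀ x ∈ Ioo 0 b, 0 < g' x) {x : ℝ} (hx : x ∈ Ioo 0 b) : 0 < g x := by
  obtain ⟨c, hc, h⟩ := exists_hasDerivAt_eq_slope g g' hx.1
    (fun y _ => (hg y).continuousAt.continuousWithinAt) (fun y _ => hg y)
  have h1 := hpos c ⟨hc.1, hc.2.trans hx.2⟩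
  rw [h, hg0, sub_zero, sub_zero] at h1
  exact (div_pos_iff_of_pos_right hx.1).1 h1

/-- The monotone form of l'Hôpital's rule. -/
theorem strictAntiOn_div_of_hasDerivAt {f f' g g' : ℝ → ℝ} {b : ℝ}
    (hf : ∀ x, HasDerivAt f (f' x) x) (hg : ∀ x, HasDerivAt g (g' x) x)
    (hf0 : f 0 = 0) (hg0 : g 0 = 0) (hpos : ∀ x ∈ Ioo 0 b, 0 < g' x)
    (hanti : StrictAntiOn (fun x => f' x / g' x) (Ioo 0 b)) :
    StrictAntiOn (fun x => f x / g x) (Ioo 0 b) := by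
  intro x hx y hy hxy
  have gx := pos_of_hasDerivAt_pos hg hg0 hpos hx
  obtain ⟨c, hc, h1⟩ := exists_ratio_hasDerivAt_eq_ratio_slope f f' hx.1
    (fun z _ => (hf z).continuousAt.continuousWithinAt) (fun z _ => hf z) g g'
    (fun z _ => (hg z).continuousAt.continuousWithinAt) (fun z _ => hg z)
  obtain ⟨d, hd, h2⟩ := exists_ratio_hasDerivAt_eq_ratio_slope f f' hxy
    (fun z _ => (hf z).continuousAt.continuousWithinAt) (fun z _ => hf z) g g'
    (fun z _ => (hg z).continuousAt.continuousWithinAt) (fun z _ => hg z)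
  have hcI : c ∈ Ioo 0 b := ⟨hc.1, hc.2.trans hx.2⟩
  have hdI : d ∈ Ioo 0 b := ⟨hx.1.trans hd.1, hd.2.trans hy.2⟩
  have gxy : 0 < g y - g x := by
    obtain ⟨z, hz, h⟩ := exists_hasDerivAt_eq_slope g g' hxy
      (fun y _ => (hg y).continuousAt.continuousWithinAt) (fun y _ => hg y)
    have h3 := hpos z ⟨hx.1.trans hz.1, hz.2.trans hy.2⟩
    rw [h] at h3
    exact (div_pos_iff_of_pos_right (sub_pos.2 hxy)).1 h3
  -- By Cauchy's mean value theorem these are the chord ratios over [x, y] and [0, x]; f y / g y is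
  -- their mediant, hence below f x / g x.
  have hcd : f' d / g' d < f' c / g' c := hanti hcI hdI (hc.2.trans hd.1)
  have gc := hpos c hcI
  have gd := hpos d hdI
  rw [hf0, hg0, sub_zero, sub_zero] at h1
  have e1 : f' c / g' c = f x / g x := by rw [div_eq_div_iff gc.ne' gx.ne']; linarith
  have e2 : f' d / g' d = (f y - f x) / (g y - g x) := by
    rw [div_eq_div_iff gd.ne' gxy.ne']; linarith
  rw [e1, e2, div_lt_div_iff₀ gxy gx] at hcd
  change f y / g y < f x / g x
  rw [div_lt_div_iff₀ (by linarith) gx]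
  linarith

theorem tendsto_div_of_hasDerivAt {f f' g g' : ℝ → ℝ} {b L : ℝ} (hb : 0 < b)
    (hf : ∀ x, HasDerivAt f (f' x) x) (hg : ∀ x, HasDerivAt g (g' x) x)
    (hf0 : f 0 = 0) (hg0 : g 0 = 0) (hpos : ∀ x ∈ Ioo 0 b, 0 < g' x)
    (hlim : Tendsto (fun x => f' x / g' x) (𝓝[>] 0) (𝓝 L)) :
    Tendsto (fun x => f x / g x) (𝓝[>] 0) (𝓝 L) := by
  refine HasDerivAt.lhopital_zero_nhdsGT (.of_forall hf) (.of_forall hg) ?_ ?_ ?_ hlim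
  · filter_upwards [Ioo_mem_nhdsGT hb] with x hx using (hpos x hx).ne'
  · simpa [hf0] using (hf 0).continuousAt.tendsto.mono_left nhdsWithin_le_nhds
  · simpa [hg0] using (hg 0).continuousAt.tendsto.mono_left nhdsWithin_le_nhds

theorem lt_of_strictAntiOn_of_tendsto {φ : ℝ → ℝ} {b L : ℝ} (h : StrictAntiOn φ (Ioo 0 b))
    (hlim : Tendsto φ (𝓝[>] 0) (𝓝 L)) {x : ℝ} (hx : x ∈ Ioo 0 b) : φ x < L := by
  have hx2 : x / 2 ∈ Ioo 0 b := ⟨half_pos hx.1, (half_lt_self hx.1).trans hx.2⟩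
  refine (h hx2 hx (half_lt_self hx.1)).trans_le (ge_of_tendsto hlim ?_)
  filter_upwards [Ioo_mem_nhdsGT hx2.1] with y hy
  exact (h ⟨hy.1, hy.2.trans hx2.2⟩ hx2 hy.2).le

/-! ### Half-angle quotients on (0, π) -/

theorem mul_cos_lt_sin {u : ℝ} (hu : u ∈ Ioo 0 Real.pi) : u * Real.cos u < Real.sin u := by
  have := pos_of_hasDerivAt_pos (g := fun u => Real.sin u - u * Real.cos u)
    (g' := fun u => u * Real.sin u) (b := Real.pi)
    (fun x => by
      refine ((Real.hasDerivAt_sin x).sub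
        ((hasDerivAt_id x).mul (Real.hasDerivAt_cos x))).congr_deriv ?_
      simp) (by simp) (fun x hx => mul_pos hx.1 (Real.sin_pos_of_mem_Ioo hx)) hu
  simpa using this

theorem strictAntiOn_mul_cos_div_sin :
    StrictAntiOn (fun u => u * Real.cos u / Real.sin u) (Ioo 0 Real.pi) := by
  have hd : ∀ u ∈ Ioo 0 Real.pi, HasDerivAt (fun u => u * Real.cos u / Real.sin u)
      ((Real.sin u * Real.cos u - u) / Real.sin u ^ 2) u := by
    intro u hu
    have hs := Real.sin_pos_of_mem_Ioo hu
    refine (((hasDerivAt_id u).mul (Real.hasDerivAt_cos u)).div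
      (Real.hasDerivAt_sin u) hs.ne').congr_deriv ?_
    simp only [id, Pi.mul_apply]
    congr 1
    linear_combination (-u) * Real.sin_sq_add_cos_sq u
  refine strictAntiOn_of_hasDerivWithinAt_neg (convex_Ioo _ _)
    (fun u hu => (hd u hu).continuousAt.continuousWithinAt)
    (f' := fun u => (Real.sin u * Real.cos u - u) / Real.sin u ^ 2)
    (fun u hu => (hd u (interior_subset hu)).hasDerivWithinAt) ?_
  intro u hu
  have hu := interior_subset hu
  have hs := Real.sin_pos_of_mem_Ioo hu
  refine div_neg_of_neg_of_pos ?_ (by positivity)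
  nlinarith [Real.sin_lt hu.1, Real.cos_le_one u]

theorem tendsto_mul_cos_div_sin :
    Tendsto (fun u => u * Real.cos u / Real.sin u) (𝓝[>] 0) (𝓝 1) := by
  refine HasDerivAt.lhopital_zero_nhdsGT
    (f' := fun u => Real.cos u - u * Real.sin u) (g' := Real.cos)
    (.of_forall fun x => ?_) (.of_forall Real.hasDerivAt_sin) ?_ ?_ ?_ ?_
  · refine ((hasDerivAt_id x).mul (Real.hasDerivAt_cos x)).congr_deriv ?_
    simp; ring
  · filter_upwards [Ioo_mem_nhdsGT (one_pos (α := ℝ))] with x hx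
    exact (Real.cos_pos_of_le_one (by rw [abs_of_pos hx.1]; exact hx.2.le)).ne'
  · have : Continuous fun u => u * Real.cos u := by fun_prop
    simpa using (this.tendsto 0).mono_left nhdsWithin_le_nhds
  · simpa using (Real.continuous_sin.tendsto 0).mono_left nhdsWithin_le_nhds
  · have : ContinuousAt (fun u => (Real.cos u - u * Real.sin u) / Real.cos u) 0 :=
      ContinuousAt.div (by fun_prop) (by fun_prop) (by simp)
    simpa using this.tendsto.mono_left nhdsWithin_le_nhds

theorem hasDerivAt_sq_mul_sin (u : ℝ) : HasDerivAt (fun u => u ^ 2 * Real.sin u)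
    (2 * u * Real.sin u + u ^ 2 * Real.cos u) u := by
  refine ((hasDerivAt_pow 2 u).mul (Real.hasDerivAt_sin u)).congr_deriv ?_
  simp

theorem hasDerivAt_sin_sub_mul_cos (u : ℝ) : HasDerivAt (fun u => Real.sin u - u * Real.cos u)
    (u * Real.sin u) u := by
  refine ((Real.hasDerivAt_sin u).sub
    ((hasDerivAt_id u).mul (Real.hasDerivAt_cos u))).congr_deriv ?_
  simp

theorem sq_mul_sin_deriv_ratio {u : ℝ} (hu : u ∈ Ioo 0 Real.pi) :
    (2 * u * Real.sin u + u ^ 2 * Real.cos u) / (u * Real.sin u)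
      = 2 + u * Real.cos u / Real.sin u := by
  have hs := Real.sin_pos_of_mem_Ioo hu
  have := hu.1
  field_simp

/-- The quotient of derivatives is 2 + u cot u, which decreases. -/
theorem strictAntiOn_sq_mul_sin_div :
    StrictAntiOn (fun u => u ^ 2 * Real.sin u / (Real.sin u - u * Real.cos u))
      (Ioo 0 Real.pi) := by
  refine strictAntiOn_div_of_hasDerivAt hasDerivAt_sq_mul_sin hasDerivAt_sin_sub_mul_cos
    (by simp) (by simp) (fun x hx => mul_pos hx.1 (Real.sin_pos_of_mem_Ioo hx)) ?_
  intro u hu v hv huv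
  have := strictAntiOn_mul_cos_div_sin hu hv huv
  simp only [sq_mul_sin_deriv_ratio hu, sq_mul_sin_deriv_ratio hv] at this ⊢
  linarith

theorem tendsto_sq_mul_sin_div :
    Tendsto (fun u => u ^ 2 * Real.sin u / (Real.sin u - u * Real.cos u)) (𝓝[>] 0) (𝓝 3) := by
  refine tendsto_div_of_hasDerivAt Real.pi_pos hasDerivAt_sq_mul_sin hasDerivAt_sin_sub_mul_cos
    (by simp) (by simp) (fun x hx => mul_pos hx.1 (Real.sin_pos_of_mem_Ioo hx)) ?_
  have h := tendsto_mul_cos_div_sin.const_add 2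
  norm_num at h
  refine h.congr' ?_
  filter_upwards [Ioo_mem_nhdsGT Real.pi_pos] with u hu
  exact (sq_mul_sin_deriv_ratio hu).symm

/-! ### Monotonicity of the critical parameter -/

/-- The function `-x⁴ B'(x) / 6`, where `B(x) = 6 (x - sin x) / x³`. -/
noncomputable def eFun (x : ℝ) : ℝ := 2 * x + x * Real.cos x - 3 * Real.sin x

/-- The derivative of `eFun`. -/
noncomputable def eDeriv (x : ℝ) : ℝ := 2 - 2 * Real.cos x - x * Real.sin x

/-- The second derivative of `eFun`. -/
noncomputable def eDerivTwo (x : ℝ) : ℝ := Real.sin x - x * Real.cos x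

/-- The part of the equation for `θ₃(l)` that is free of `l`. -/
noncomputable def nFun (x : ℝ) : ℝ :=
  3 * x ^ 4 + 36 * x ^ 2 * Real.cos x - 72 * Real.cos x + 6 * x ^ 3 * Real.sin x
    - 72 * x * Real.sin x + 72

/-- The value of `l` for which `x` solves the equation for `θ₃(l)`. -/
noncomputable def critParam (x : ℝ) : ℝ := nFun x / (2 * x ^ 3 * eFun x)

theorem hasDerivAt_eFun (x : ℝ) : HasDerivAt eFun (eDeriv x) x := by
  refine ((((hasDerivAt_id x).const_mul 2).add
    ((hasDerivAt_id x).mul (Real.hasDerivAt_cos x))).sub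
    ((Real.hasDerivAt_sin x).const_mul 3)).congr_deriv ?_
  simp [eDeriv]; ring

theorem hasDerivAt_eDeriv (x : ℝ) : HasDerivAt eDeriv (eDerivTwo x) x := by
  refine ((((Real.hasDerivAt_cos x).const_mul 2).const_sub 2).sub
    ((hasDerivAt_id x).mul (Real.hasDerivAt_sin x))).congr_deriv ?_
  simp [eDerivTwo]; ring

theorem hasDerivAt_nFun (x : ℝ) : HasDerivAt nFun (6 * x ^ 2 * eFun x) x := by
  have h2 := ((hasDerivAt_pow 2 x).const_mul 36).mul (Real.hasDerivAt_cos x)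
  have h3 := ((hasDerivAt_pow 3 x).const_mul 6).mul (Real.hasDerivAt_sin x)
  have h4 := ((hasDerivAt_id x).const_mul 72).mul (Real.hasDerivAt_sin x)
  refine (((((((hasDerivAt_pow 4 x).const_mul 3).add h2).sub
    ((Real.hasDerivAt_cos x).const_mul 72)).add h3).sub h4).add_const 72).congr_deriv ?_
  simp [eFun]; ring

theorem half_mem_Ioo {x : ℝ} (hx : x ∈ Ioo 0 (2 * Real.pi)) : x / 2 ∈ Ioo 0 Real.pi :=
  ⟨by linarith [hx.1], by linarith [hx.2]⟩

theorem eDeriv_eq (x : ℝ) : eDeriv x =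
    4 * Real.sin (x / 2) * (Real.sin (x / 2) - x / 2 * Real.cos (x / 2)) := by
  have h := Real.sin_two_mul (x / 2)
  have h' := Real.cos_two_mul (x / 2)
  rw [mul_div_cancel₀ x two_ne_zero] at h h'
  rw [eDeriv, h, h']
  linear_combination (-4) * Real.sin_sq_add_cos_sq (x / 2)

theorem eDerivTwo_eq (x : ℝ) : eDerivTwo x =
    2 * (Real.cos (x / 2) * (Real.sin (x / 2) - x / 2 * Real.cos (x / 2))
      + x / 2 * Real.sin (x / 2) ^ 2) := by
  have h := Real.sin_two_mul (x / 2)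
  have h' := Real.cos_two_mul (x / 2)
  rw [mul_div_cancel₀ x two_ne_zero] at h h'
  rw [eDerivTwo, h, h']
  linear_combination (-x) * Real.sin_sq_add_cos_sq (x / 2)

theorem eDeriv_pos {x : ℝ} (hx : x ∈ Ioo 0 (2 * Real.pi)) : 0 < eDeriv x := by
  have h := half_mem_Ioo hx
  rw [eDeriv_eq]
  exact mul_pos (mul_pos four_pos (Real.sin_pos_of_mem_Ioo h)) (sub_pos.2 (mul_cos_lt_sin h))

theorem eFun_pos {x : ℝ} (hx : 0 < x) : 0 < eFun x := by
  rcases lt_or_ge x (2 * Real.pi) with h | h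
  · exact pos_of_hasDerivAt_pos hasDerivAt_eFun (by simp [eFun]) (fun _ => eDeriv_pos) ⟨hx, h⟩
  · unfold eFun
    nlinarith [Real.neg_one_le_cos x, Real.sin_le_one x, Real.pi_gt_three]

/-- With u = x/2 the logarithmic derivative of `eDeriv` splits into the two decreasing half-angle
quotients, with limits 1 and 3 at 0. -/
theorem eDeriv_ratio {x : ℝ} (hx : x ∈ Ioo 0 (2 * Real.pi)) :
    (eDeriv x + x * eDerivTwo x) / eDeriv x =
      1 + (x / 2 * Real.cos (x / 2) / Real.sin (x / 2)
        + (x / 2) ^ 2 * Real.sin (x / 2) / (Real.sin (x / 2) - x / 2 * Real.cos (x / 2))) := by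
  have h := half_mem_Ioo hx
  have h1 := (Real.sin_pos_of_mem_Ioo h).ne'
  have h2 := (sub_pos.2 (mul_cos_lt_sin h)).ne'
  have h3 := (eDeriv_pos hx).ne'
  rw [add_div, div_self h3, eDerivTwo_eq, eDeriv_eq]
  congr 1
  generalize Real.sin (x / 2) = S at *
  generalize Real.cos (x / 2) = C at *
  rw [div_add_div _ _ h1 h2, div_eq_div_iff (by positivity) (by positivity)]
  ring

theorem tendsto_half_nhdsGT_zero : Tendsto (fun x : ℝ => x / 2) (𝓝[>] 0) (𝓝[>] 0) := by
  refine tendsto_nhdsWithin_iff.2 ⟨?_, ?_⟩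
  · have : Continuous fun x : ℝ => x / 2 := by fun_prop
    simpa using (this.tendsto 0).mono_left nhdsWithin_le_nhds
  · filter_upwards [self_mem_nhdsWithin] with x hx using half_pos (mem_Ioi.1 hx)

theorem hasDerivAt_mul_eDeriv (x : ℝ) :
    HasDerivAt (fun x => x * eDeriv x) (eDeriv x + x * eDerivTwo x) x := by
  refine ((hasDerivAt_id x).mul (hasDerivAt_eDeriv x)).congr_deriv ?_
  simp

theorem strictAntiOn_mul_eDeriv_div :
    StrictAntiOn (fun x => x * eDeriv x / eFun x) (Ioo 0 (2 * Real.pi)) := by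
  refine strictAntiOn_div_of_hasDerivAt hasDerivAt_mul_eDeriv hasDerivAt_eFun
    (by simp) (by simp [eFun]) (fun _ => eDeriv_pos) ?_
  intro x hx y hy hxy
  have hxy' : x / 2 < y / 2 := by linarith
  have h1 := strictAntiOn_mul_cos_div_sin (half_mem_Ioo hx) (half_mem_Ioo hy) hxy'
  have h2 := strictAntiOn_sq_mul_sin_div (half_mem_Ioo hx) (half_mem_Ioo hy) hxy'
  simp only [eDeriv_ratio hx, eDeriv_ratio hy] at h1 h2 ⊢
  linarith

theorem tendsto_mul_eDeriv_div :
    Tendsto (fun x => x * eDeriv x / eFun x) (𝓝[>] 0) (𝓝 5) := by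
  refine tendsto_div_of_hasDerivAt Real.two_pi_pos hasDerivAt_mul_eDeriv hasDerivAt_eFun
    (by simp) (by simp [eFun]) (fun _ => eDeriv_pos) ?_
  have h := ((tendsto_mul_cos_div_sin.comp tendsto_half_nhdsGT_zero).add
    (tendsto_sq_mul_sin_div.comp tendsto_half_nhdsGT_zero)).const_add 1
  norm_num at h
  refine h.congr' ?_
  filter_upwards [Ioo_mem_nhdsGT Real.two_pi_pos] with x hx
  exact (eDeriv_ratio hx).symm

theorem hasDerivAt_cube_mul_eFun (x : ℝ) :
    HasDerivAt (fun x => 2 * x ^ 3 * eFun x) (6 * x ^ 2 * eFun x + 2 * x ^ 3 * eDeriv x) x := by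
  refine (((hasDerivAt_pow 3 x).const_mul 2).mul (hasDerivAt_eFun x)).congr_deriv ?_
  push_cast
  ring

theorem cube_mul_eFun_deriv_pos {x : ℝ} (hx : x ∈ Ioo 0 (2 * Real.pi)) :
    0 < 6 * x ^ 2 * eFun x + 2 * x ^ 3 * eDeriv x := by
  have := hx.1
  have := eFun_pos this
  have := eDeriv_pos hx
  positivity

theorem nFun_deriv_ratio {x : ℝ} (hx : x ∈ Ioo 0 (2 * Real.pi)) :
    6 * x ^ 2 * eFun x / (6 * x ^ 2 * eFun x + 2 * x ^ 3 * eDeriv x)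
      = 3 / (3 + x * eDeriv x / eFun x) := by
  have h0 := hx.1
  have h1 := eFun_pos h0
  have h2 := eDeriv_pos hx
  have h3 := cube_mul_eFun_deriv_pos hx
  field_simp
  ring

/-- The quotient of derivatives is 3 / (3 + x E'/E) with E = `eFun`, and x E'/E decreases by a
second use of the same rule. The sign change on `nFun` turns the increasing quotient into a
decreasing one. -/
theorem strictMonoOn_critParam : StrictMonoOn critParam (Ioo 0 (2 * Real.pi)) := by
  have h : StrictAntiOn (fun x => (-nFun x) / (2 * x ^ 3 * eFun x)) (Ioo 0 (2 * Real.pi)) := by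
    refine strictAntiOn_div_of_hasDerivAt (fun x => (hasDerivAt_nFun x).neg)
      hasDerivAt_cube_mul_eFun (by simp [nFun]) (by simp)
      (fun _ => cube_mul_eFun_deriv_pos) ?_
    intro x hx y hy hxy
    have h := strictAntiOn_mul_eDeriv_div hx hy hxy
    have h0 := hy.1
    have h1 := eFun_pos h0
    have h2 := eDeriv_pos hy
    simp only [neg_div, nFun_deriv_ratio hx, nFun_deriv_ratio hy]
    refine neg_lt_neg (div_lt_div_of_pos_left three_pos (by positivity) ?_)
    exact add_lt_add_right h 3
  intro x hx y hy hxy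
  have := h hx hy hxy
  simp only [neg_div] at this
  exact neg_lt_neg_iff.1 this

/-- Since x E'/E tends to 5, the limit is 3 / (3 + 5). -/
theorem tendsto_critParam : Tendsto critParam (𝓝[>] 0) (𝓝 (3 / 8)) := by
  refine tendsto_div_of_hasDerivAt Real.two_pi_pos hasDerivAt_nFun hasDerivAt_cube_mul_eFun
    (by simp [nFun]) (by simp) (fun _ => cube_mul_eFun_deriv_pos) ?_
  have h := (tendsto_const_nhds (x := (3 : ℝ))).div (tendsto_mul_eDeriv_div.const_add 3)
    (by norm_num)
  norm_num at h
  refine h.congr' ?_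
  filter_upwards [Ioo_mem_nhdsGT Real.two_pi_pos] with x hx
  exact (nFun_deriv_ratio hx).symm

theorem lt_critParam {x : ℝ} (hx : x ∈ Ioo 0 (2 * Real.pi)) : 3 / 8 < critParam x := by
  have h := lt_of_strictAntiOn_of_tendsto (φ := fun x => -critParam x) (L := -(3 / 8))
    (fun x hx y hy h => neg_lt_neg (strictMonoOn_critParam hx hy h)) tendsto_critParam.neg hx
  linarith

theorem continuousOn_critParam : ContinuousOn critParam (Ioi 0) := by
  intro x hx
  refine ContinuousAt.continuousWithinAt (ContinuousAt.div (hasDerivAt_nFun x).continuousAt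
    (hasDerivAt_cube_mul_eFun x).continuousAt ?_)
  have := eFun_pos hx
  have : 0 < x := hx
  positivity

theorem isThetaRoot_iff {l x : ℝ} :
    IsThetaRoot l x ↔ x ∈ Ioo 0 (2 * Real.pi) ∧ critParam x = l := by
  refine and_congr_right fun hx => ?_
  have h0 := hx.1
  have h1 := eFun_pos h0
  rw [critParam, div_eq_iff (by positivity)]
  unfold nFun eFun
  constructor <;> intro h <;> linarith

theorem exists_critParam_eq {l t : ℝ} (hl : 3 / 8 < l) (ht : t ∈ Ioo 0 (2 * Real.pi))
    (hlt : l ≤ critParam t) : ∃ x ∈ Ioc 0 t, critParam x = l := by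
  obtain ⟨s, hs1, hs2⟩ := ((tendsto_critParam.eventually_lt_const hl).and
    (Ioo_mem_nhdsGT ht.1)).exists
  obtain ⟨x, hx, h⟩ := intermediate_value_Icc hs2.2.le
    (continuousOn_critParam.mono fun y hy => hs2.1.trans_le hy.1) ⟨hs1.le, hlt⟩
  exact ⟨x, ⟨hs2.1.trans_le hx.1, hx.2⟩, h⟩

/-! ### The curve F and its distance to l -/

/-- The imaginary part of `6 (e^{ix} - 1 - ix + x²/2) / (ix)³`. -/
noncomputable def aFun (x : ℝ) : ℝ := 6 * (Real.cos x - 1 + x ^ 2 / 2) / x ^ 3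

/-- The real part of `6 (e^{ix} - 1 - ix + x²/2) / (ix)³`. -/
noncomputable def bFun (x : ℝ) : ℝ := 6 * (x - Real.sin x) / x ^ 3

/-- The square of `expTaylorRatio 3 l`. -/
noncomputable def ratioSq (l x : ℝ) : ℝ := aFun x ^ 2 + (bFun x - l) ^ 2

theorem norm_exp_sub_taylor (l x : ℝ) :
    ‖Complex.exp (Complex.I * (x : ℂ))
      - ∑ k ∈ Finset.range 3, (Complex.I * (x : ℂ)) ^ k / (k.factorial : ℂ)
      - (l : ℂ) * ((Complex.I * (x : ℂ)) ^ 3 / (Nat.factorial 3 : ℂ))‖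
    = Real.sqrt ((Real.cos x - 1 + x ^ 2 / 2) ^ 2 + (Real.sin x - x + l * x ^ 3 / 6) ^ 2) := by
  have h : Complex.exp (Complex.I * (x : ℂ))
      - ∑ k ∈ Finset.range 3, (Complex.I * (x : ℂ)) ^ k / (k.factorial : ℂ)
      - (l : ℂ) * ((Complex.I * (x : ℂ)) ^ 3 / (Nat.factorial 3 : ℂ))
      = ((Real.cos x - 1 + x ^ 2 / 2 : ℝ) : ℂ)
        + ((Real.sin x - x + l * x ^ 3 / 6 : ℝ) : ℂ) * Complex.I := by
    have h3 : Complex.I ^ 3 = -Complex.I := by rw [pow_succ, Complex.I_sq]; ring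
    rw [mul_comm, Complex.exp_mul_I]
    simp only [Finset.sum_range_succ, Finset.sum_range_zero, mul_pow, h3, Complex.I_sq]
    simp [Nat.factorial]
    ring
  rw [h, Complex.norm_add_mul_I]

theorem expTaylorRatio_eq {l x : ℝ} :
    expTaylorRatio 3 l x = 6 / x ^ 3 *
      Real.sqrt ((Real.cos x - 1 + x ^ 2 / 2) ^ 2 + (Real.sin x - x + l * x ^ 3 / 6) ^ 2) := by
  rw [expTaylorRatio, norm_exp_sub_taylor]
  norm_num [Nat.factorial]

theorem expTaylorRatio_eq_sqrt {l x : ℝ} (hx : 0 < x) :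
    expTaylorRatio 3 l x = Real.sqrt (ratioSq l x) := by
  have h6 : (6 / x ^ 3 : ℝ) = Real.sqrt ((6 / x ^ 3) ^ 2) := (Real.sqrt_sq (by positivity)).symm
  rw [expTaylorRatio_eq, h6, ← Real.sqrt_mul (by positivity), ratioSq, aFun, bFun]
  congr 1
  field_simp
  ring

/-- The numerator shows that θ₃* is a critical point of A. -/
theorem hasDerivAt_aFun {x : ℝ} (hx : 0 < x) : HasDerivAt aFun
    (-3 * (x ^ 2 + 2 * x * Real.sin x + 6 * (Real.cos x - 1)) / x ^ 4) x := by
  refine (((((Real.hasDerivAt_cos x).sub_const 1).add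
    ((hasDerivAt_pow 2 x).div_const 2)).const_mul 6).div
    (hasDerivAt_pow 3 x) (by positivity)).congr_deriv ?_
  simp only [Pi.add_apply]
  field_simp
  push_cast
  ring

theorem hasDerivAt_bFun {x : ℝ} (hx : 0 < x) : HasDerivAt bFun (-(6 * eFun x) / x ^ 4) x := by
  refine ((((hasDerivAt_id x).sub (Real.hasDerivAt_sin x)).const_mul 6).div
    (hasDerivAt_pow 3 x) (by positivity)).congr_deriv ?_
  simp only [Pi.sub_apply, id, eFun]
  field_simp
  push_cast
  ring

theorem hasDerivAt_ratioSq {x : ℝ} (l : ℝ) (hx : 0 < x) : HasDerivAt (ratioSq l)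
    (6 / x ^ 7 * (l * (2 * x ^ 3 * eFun x) - nFun x)) x := by
  refine (((hasDerivAt_aFun hx).pow 2).add
    (((hasDerivAt_bFun hx).sub_const l).pow 2)).congr_deriv ?_
  simp only [aFun, bFun, nFun, eFun, Nat.cast_ofNat, Nat.add_one_sub_one, pow_one]
  field_simp
  linear_combination (-36) * Real.sin_sq_add_cos_sq x

theorem tendsto_aFun : Tendsto aFun (𝓝[>] 0) (𝓝 0) := by
  refine tendsto_div_of_hasDerivAt one_pos
    (f' := fun x => 6 * (x - Real.sin x)) (g' := fun x => 3 * x ^ 2) (fun x => ?_) (fun x => ?_)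
    (by simp) (by simp) (fun x hx => by have := hx.1; positivity) ?_
  · refine ((((Real.hasDerivAt_cos x).sub_const 1).add
      ((hasDerivAt_pow 2 x).div_const 2)).const_mul 6).congr_deriv ?_
    push_cast
    ring
  · exact (hasDerivAt_pow 3 x).congr_deriv (by push_cast; ring)
  refine tendsto_div_of_hasDerivAt one_pos
    (f' := fun x => 6 * (1 - Real.cos x)) (g' := fun x => 6 * x) (fun x => ?_) (fun x => ?_)
    (by simp) (by simp) (fun x hx => by have := hx.1; positivity) ?_
  · exact ((hasDerivAt_id x).sub (Real.hasDerivAt_sin x)).const_mul 6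
  · exact ((hasDerivAt_pow 2 x).const_mul 3).congr_deriv (by push_cast; ring)
  refine tendsto_div_of_hasDerivAt one_pos
    (f' := fun x => 6 * Real.sin x) (g' := fun x => 6) (fun x => ?_) (fun x => ?_)
    (by simp) (by simp) (fun x hx => by norm_num) ?_
  · exact (((Real.hasDerivAt_cos x).const_sub 1).const_mul 6).congr_deriv (by ring)
  · exact ((hasDerivAt_id x).const_mul 6).congr_deriv (by ring)
  have : Continuous fun x => 6 * Real.sin x / 6 := by fun_prop
  simpa using (this.tendsto 0).mono_left nhdsWithin_le_nhds

theorem tendsto_bFun : Tendsto bFun (𝓝[>] 0) (𝓝 1) := by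
  refine tendsto_div_of_hasDerivAt one_pos
    (f' := fun x => 6 * (1 - Real.cos x)) (g' := fun x => 3 * x ^ 2) (fun x => ?_) (fun x => ?_)
    (by simp) (by simp) (fun x hx => by have := hx.1; positivity) ?_
  · exact ((hasDerivAt_id x).sub (Real.hasDerivAt_sin x)).const_mul 6
  · exact (hasDerivAt_pow 3 x).congr_deriv (by push_cast; ring)
  refine tendsto_div_of_hasDerivAt one_pos
    (f' := fun x => 6 * Real.sin x) (g' := fun x => 6 * x) (fun x => ?_) (fun x => ?_)
    (by simp) (by simp) (fun x hx => by have := hx.1; positivity) ?_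
  · exact (((Real.hasDerivAt_cos x).const_sub 1).const_mul 6).congr_deriv (by ring)
  · exact ((hasDerivAt_pow 2 x).const_mul 3).congr_deriv (by push_cast; ring)
  refine tendsto_div_of_hasDerivAt one_pos
    (f' := fun x => 6 * Real.cos x) (g' := fun x => 6) (fun x => ?_) (fun x => ?_)
    (by simp) (by simp) (fun x hx => by norm_num) ?_
  · exact (Real.hasDerivAt_sin x).const_mul 6
  · exact ((hasDerivAt_id x).const_mul 6).congr_deriv (by ring)
  have : Continuous fun x => 6 * Real.cos x / 6 := by fun_prop
  simpa using (this.tendsto 0).mono_left nhdsWithin_le_nhds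

theorem tendsto_ratioSq (l : ℝ) : Tendsto (ratioSq l) (𝓝[>] 0) (𝓝 ((1 - l) ^ 2)) := by
  have h := (tendsto_aFun.pow 2).add ((tendsto_bFun.sub_const l).pow 2)
  rw [zero_pow two_ne_zero, zero_add] at h
  exact h

theorem ratioSq_deriv_eq {x : ℝ} (l : ℝ) (hx : 0 < x) :
    6 / x ^ 7 * (l * (2 * x ^ 3 * eFun x) - nFun x)
      = 12 * eFun x / x ^ 4 * (l - critParam x) := by
  have := eFun_pos hx
  rw [critParam]
  field_simp
  ring

theorem antitoneOn_ratioSq {l a b : ℝ} (ha : 0 < a)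
    (h : ∀ x ∈ Ioo a b, l ≤ critParam x) : AntitoneOn (ratioSq l) (Icc a b) := by
  refine antitoneOn_of_hasDerivWithinAt_nonpos (convex_Icc a b)
    (fun x hx => (hasDerivAt_ratioSq l (ha.trans_le hx.1)).continuousAt.continuousWithinAt)
    (fun x hx => (hasDerivAt_ratioSq l
      (ha.trans_le (interior_subset hx).1)).hasDerivWithinAt) fun x hx => ?_
  rw [interior_Icc] at hx
  have hx0 := ha.trans hx.1
  have := eFun_pos hx0
  rw [ratioSq_deriv_eq l hx0]
  exact mul_nonpos_of_nonneg_of_nonpos (by positivity) (sub_nonpos.2 (h x hx))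

theorem monotoneOn_ratioSq {l a b : ℝ} (ha : 0 < a)
    (h : ∀ x ∈ Ioo a b, critParam x ≤ l) : MonotoneOn (ratioSq l) (Icc a b) := by
  refine monotoneOn_of_hasDerivWithinAt_nonneg (convex_Icc a b)
    (fun x hx => (hasDerivAt_ratioSq l (ha.trans_le hx.1)).continuousAt.continuousWithinAt)
    (fun x hx => (hasDerivAt_ratioSq l
      (ha.trans_le (interior_subset hx).1)).hasDerivWithinAt) fun x hx => ?_
  rw [interior_Icc] at hx
  have hx0 := ha.trans hx.1
  have := eFun_pos hx0
  rw [ratioSq_deriv_eq l hx0]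
  exact mul_nonneg (by positivity) (sub_nonneg.2 (h x hx))

/-! ### Global maximum, including x ≥ 2π -/

/-- For w = 1/x one has 0 ≤ A ≤ 3w and |B - 6w²| ≤ 6w³, while at π everything is explicit in z =
1/π². As w² ≤ z/4, the tail is smaller by a factor of about 4 after l² is subtracted. The bound
0.4467 on l exceeds λ*. -/
theorem ratioSq_le_at_pi {l x : ℝ} (hl0 : 0 ≤ l) (hl : l ≤ 0.4467) (hx : 2 * Real.pi ≤ x) :
    ratioSq l x ≤ ratioSq l Real.pi := by
  have hpi := Real.pi_gt_d4
  have hpi' := Real.pi_lt_d4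
  have hx0 : 0 < x := by linarith
  set w := x⁻¹ with hw
  have hw0 : 0 < w := inv_pos.2 hx0
  have hxw : x * w = 1 := mul_inv_cancel₀ hx0.ne'
  set z := (Real.pi ^ 2)⁻¹ with hz
  have hzz : Real.pi ^ 2 * z = 1 := mul_inv_cancel₀ (by positivity)
  have hz0 : 0 < z := by positivity
  have hwz : w ^ 2 ≤ z / 4 := by
    have h : w ≤ (2 * Real.pi)⁻¹ := inv_anti₀ (by positivity) hx
    calc w ^ 2 ≤ ((2 * Real.pi)⁻¹) ^ 2 := pow_le_pow_left₀ hw0.le h 2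
      _ = z / 4 := by rw [hz]; field_simp; norm_num
  -- The constant is 1/(2π) rounded up.
  have hw1 : w ≤ 0.1592 := by nlinarith
  have hA0 : 0 ≤ aFun x := by
    have := Real.one_sub_sq_div_two_le_cos (x := x)
    exact div_nonneg (by linarith) (by positivity)
  have hA : aFun x ≤ 3 * w := by
    rw [aFun, hw, div_le_iff₀ (by positivity)]
    have := Real.cos_le_one x
    field_simp
    linarith
  have hB : bFun x ≤ 6 * w ^ 2 + 6 * w ^ 3 := by
    rw [bFun, hw, div_le_iff₀ (by positivity)]
    have := Real.neg_one_le_sin x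
    field_simp
    linarith
  have hB' : 6 * w ^ 2 - 6 * w ^ 3 ≤ bFun x := by
    rw [bFun, hw, le_div_iff₀ (by positivity)]
    have := Real.sin_le_one x
    field_simp
    linarith
  have hB0 : 0 ≤ bFun x := le_trans (by nlinarith [pow_pos hw0 2]) hB'
  have hP : ratioSq l Real.pi - l ^ 2 = (9 - 12 * l) * z - 36 * z ^ 2 + 144 * z ^ 3 := by
    rw [ratioSq, aFun, bFun, hz, Real.cos_pi, Real.sin_pi]
    field_simp
    ring
  have h1 : ratioSq l x - l ^ 2
      ≤ 9 * w ^ 2 + (6 * w ^ 2 + 6 * w ^ 3) ^ 2 - 2 * l * (6 * w ^ 2 - 6 * w ^ 3) := by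
    have e1 := pow_le_pow_left₀ hA0 hA 2
    have e2 := pow_le_pow_left₀ hB0 hB 2
    have e3 := mul_le_mul_of_nonneg_left hB' (by positivity : 0 ≤ 2 * l)
    rw [ratioSq]
    linarith
  have h2 : 9 * w ^ 2 + (6 * w ^ 2 + 6 * w ^ 3) ^ 2 - 2 * l * (6 * w ^ 2 - 6 * w ^ 3)
      ≤ z / 4 * (9 - 12 * l * (1 - 0.1592) + 36 * (z / 4) * 1.1592 ^ 2) := by
    have e1 : 12 * l * w ≤ 12 * l * 0.1592 := by gcongr
    have e2 : (1 + w) ^ 2 ≤ 1.1592 ^ 2 := by gcongr; linarith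
    calc 9 * w ^ 2 + (6 * w ^ 2 + 6 * w ^ 3) ^ 2 - 2 * l * (6 * w ^ 2 - 6 * w ^ 3)
        = w ^ 2 * (9 - 12 * l + 12 * l * w + 36 * w ^ 2 * (1 + w) ^ 2) := by ring
      _ ≤ w ^ 2 * (9 - 12 * l + 12 * l * 0.1592 + 36 * (z / 4) * 1.1592 ^ 2) := by gcongr
      _ = w ^ 2 * (9 - 12 * l * (1 - 0.1592) + 36 * (z / 4) * 1.1592 ^ 2) := by ring
      _ ≤ _ := by
        refine mul_le_mul_of_nonneg_right hwz ?_
        nlinarith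
  have hz1 : z < 0.10133 := by nlinarith
  have hz2 : 0.10132 < z := by nlinarith
  have h3 : 0 ≤ (9 - 12 * l) - 36 * z + 144 * z ^ 2
      - 1 / 4 * (9 - 12 * l * (1 - 0.1592) + 36 * (z / 4) * 1.1592 ^ 2) := by
    nlinarith
  have h4 := mul_nonneg hz0.le h3
  linarith

theorem ratioSq_le_of_critParam_eq {l t x : ℝ} (hl0 : 0 ≤ l) (hl : l ≤ 0.4467)
    (ht : t ∈ Ioo 0 (2 * Real.pi)) (htl : critParam t = l) (hx : 0 < x) :
    ratioSq l x ≤ ratioSq l t := by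
  have key : ∀ y ∈ Ioo 0 (2 * Real.pi), ratioSq l y ≤ ratioSq l t := by
    intro y hy
    rcases le_total y t with h | h
    · refine monotoneOn_ratioSq hy.1 (fun z hz => ?_) (left_mem_Icc.2 h) (right_mem_Icc.2 h) h
      rw [← htl]
      exact strictMonoOn_critParam.monotoneOn ⟨hy.1.trans hz.1, hz.2.trans ht.2⟩ ht hz.2.le
    · refine antitoneOn_ratioSq ht.1 (fun z hz => ?_) (left_mem_Icc.2 h) (right_mem_Icc.2 h) h
      rw [← htl]
      exact strictMonoOn_critParam.monotoneOn ht ⟨ht.1.trans hz.1, hz.2.trans hy.2⟩ hz.1.le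
  rcases lt_or_ge x (2 * Real.pi) with h | h
  · exact key x ⟨hx, h⟩
  · exact (ratioSq_le_at_pi hl0 hl h).trans
      (key _ ⟨Real.pi_pos, by linarith [Real.pi_pos]⟩)

theorem ratioSq_three_eighths_le {x : ℝ} (hx : 0 < x) : ratioSq (3 / 8) x ≤ (5 / 8) ^ 2 := by
  have key : ∀ y ∈ Ioo 0 (2 * Real.pi), ratioSq (3 / 8) y ≤ (5 / 8) ^ 2 := by
    intro y hy
    have hlim := tendsto_ratioSq (3 / 8)
    norm_num at hlim ⊢
    refine ge_of_tendsto hlim ?_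
    filter_upwards [Ioo_mem_nhdsGT hy.1] with z hz
    exact antitoneOn_ratioSq hz.1
      (fun v hv => (lt_critParam ⟨hz.1.trans hv.1, hv.2.trans hy.2⟩).le)
      (left_mem_Icc.2 hz.2.le) (right_mem_Icc.2 hz.2.le) hz.2.le
  rcases lt_or_ge x (2 * Real.pi) with h | h
  · exact key x ⟨hx, h⟩
  · exact (ratioSq_le_at_pi (by norm_num) (by norm_num) h).trans
      (key _ ⟨Real.pi_pos, by linarith [Real.pi_pos]⟩)

/-! ### Taylor bounds for sine and cosine -/

theorem sum_range_mul_I_pow_div_factorial (x : ℝ) (n : ℕ) :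
    ∑ m ∈ Finset.range (2 * n), ((x : ℂ) * Complex.I) ^ m / (m.factorial : ℂ)
      = ((∑ k ∈ Finset.range n, (-1) ^ k * x ^ (2 * k) / ((2 * k).factorial : ℝ) : ℝ) : ℂ)
        + ((∑ k ∈ Finset.range n, (-1) ^ k * x ^ (2 * k + 1) / ((2 * k + 1).factorial : ℝ) : ℝ) : ℂ)
          * Complex.I := by
  induction n with
  | zero => simp
  | succ n ih =>
    have h1 : ((x : ℂ) * Complex.I) ^ (2 * n) = (-1) ^ n * (x : ℂ) ^ (2 * n) := by
      rw [mul_pow, pow_mul Complex.I, Complex.I_sq]; ring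
    have h2 : ((x : ℂ) * Complex.I) ^ (2 * n + 1)
        = (-1) ^ n * (x : ℂ) ^ (2 * n + 1) * Complex.I := by
      rw [pow_succ, h1]; ring
    rw [mul_add_one, Finset.sum_range_succ, Finset.sum_range_succ, ih, h1, h2,
      Finset.sum_range_succ, Finset.sum_range_succ]
    push_cast
    ring

theorem norm_exp_mul_I_sub_sum_le {x : ℝ} {n : ℕ} (hx : |x| ≤ n) :
    ‖Complex.exp (x * Complex.I)
      - ∑ m ∈ Finset.range (2 * n), ((x : ℂ) * Complex.I) ^ m / (m.factorial : ℂ)‖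
      ≤ |x| ^ (2 * n) / (2 * n).factorial * 2 := by
  have hn : ‖(x : ℂ) * Complex.I‖ = |x| := by simp
  have h := Complex.exp_bound' (x := x * Complex.I) (n := 2 * n) (by
    rw [hn, div_le_iff₀ (by positivity)]
    push_cast
    linarith)
  rwa [hn] at h

theorem abs_cos_sub_sum_le {x : ℝ} {n : ℕ} (hx : |x| ≤ n) :
    |Real.cos x - ∑ k ∈ Finset.range n, (-1) ^ k * x ^ (2 * k) / ((2 * k).factorial : ℝ)|
      ≤ |x| ^ (2 * n) / (2 * n).factorial * 2 := by
  refine le_trans ?_ (norm_exp_mul_I_sub_sum_le hx)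
  refine le_trans (le_of_eq ?_) (Complex.abs_re_le_norm _)
  rw [sum_range_mul_I_pow_div_factorial, Complex.sub_re, Complex.exp_ofReal_mul_I_re,
    Complex.add_re, Complex.re_ofReal_mul, Complex.ofReal_re, Complex.I_re, mul_zero, add_zero]

theorem abs_sin_sub_sum_le {x : ℝ} {n : ℕ} (hx : |x| ≤ n) :
    |Real.sin x - ∑ k ∈ Finset.range n, (-1) ^ k * x ^ (2 * k + 1) / ((2 * k + 1).factorial : ℝ)|
      ≤ |x| ^ (2 * n) / (2 * n).factorial * 2 := by
  refine le_trans ?_ (norm_exp_mul_I_sub_sum_le hx)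
  refine le_trans (le_of_eq ?_) (Complex.abs_im_le_norm _)
  rw [sum_range_mul_I_pow_div_factorial, Complex.sub_im, Complex.exp_ofReal_mul_I_im,
    Complex.add_im, Complex.im_ofReal_mul, Complex.ofReal_im, Complex.I_im, mul_one, zero_add]

/-! ### The root θ₃* and numerical values -/

/-- The function whose root in `(0, 2π)` is `θ₃*`. -/
noncomputable def starFun (x : ℝ) : ℝ := x ^ 2 + 2 * x * Real.sin x + 6 * (Real.cos x - 1)

theorem hasDerivAt_starFun (x : ℝ) : HasDerivAt starFun
    (-8 * Real.cos (x / 2) * (Real.sin (x / 2) - x / 2 * Real.cos (x / 2))) x := by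
  have h := Real.sin_two_mul (x / 2)
  have h' := Real.cos_two_mul (x / 2)
  rw [mul_div_cancel₀ x two_ne_zero] at h h'
  refine (((hasDerivAt_pow 2 x).add
    (((hasDerivAt_id x).const_mul 2).mul (Real.hasDerivAt_sin x))).add
    (((Real.hasDerivAt_cos x).sub_const 1).const_mul 6)).congr_deriv ?_
  simp only [id, h, h', Nat.cast_ofNat, Nat.add_one_sub_one, pow_one, mul_one]
  ring

theorem continuous_starFun : Continuous starFun :=
  continuous_iff_continuousAt.2 fun x => (hasDerivAt_starFun x).continuousAt

theorem strictAntiOn_starFun : StrictAntiOn starFun (Icc 0 Real.pi) := by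
  refine strictAntiOn_of_hasDerivWithinAt_neg (convex_Icc _ _) continuous_starFun.continuousOn
    (fun x _ => (hasDerivAt_starFun x).hasDerivWithinAt) fun x hx => ?_
  rw [interior_Icc] at hx
  have h1 := mul_cos_lt_sin (u := x / 2) ⟨by linarith [hx.1], by linarith [hx.2, hx.1]⟩
  have h2 : 0 < Real.cos (x / 2) :=
    Real.cos_pos_of_mem_Ioo ⟨by linarith [hx.1, Real.pi_pos], by linarith [hx.2]⟩
  exact mul_neg_of_neg_of_pos (by linarith) (sub_pos.2 h1)

theorem strictMonoOn_starFun : StrictMonoOn starFun (Icc Real.pi (2 * Real.pi)) := by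
  refine strictMonoOn_of_hasDerivWithinAt_pos (convex_Icc _ _) continuous_starFun.continuousOn
    (fun x _ => (hasDerivAt_starFun x).hasDerivWithinAt) fun x hx => ?_
  rw [interior_Icc] at hx
  have h1 := mul_cos_lt_sin (u := x / 2)
    ⟨by linarith [hx.1, Real.pi_pos], by linarith [hx.2, hx.1]⟩
  have h2 : Real.cos (x / 2) < 0 :=
    Real.cos_neg_of_pi_div_two_lt_of_lt (by linarith [hx.1]) (by linarith [hx.2, Real.pi_pos])
  exact mul_pos (by linarith) (sub_pos.2 h1)

/-- `starFun` vanishes at 0 and decreases on [0, π], so every root lies beyond π, where it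
increases. -/
theorem IsThetaStarRoot.eq {x y : ℝ} (hx : IsThetaStarRoot x) (hy : IsThetaStarRoot y) :
    x = y := by
  have key : ∀ z, IsThetaStarRoot z → z ∈ Icc Real.pi (2 * Real.pi) := by
    intro z hz
    refine ⟨le_of_not_gt fun h => ?_, hz.1.2.le⟩
    have h1 := strictAntiOn_starFun ⟨le_rfl, Real.pi_pos.le⟩ ⟨hz.1.1.le, h.le⟩ hz.1.1
    have h2 : starFun z = 0 := hz.2
    rw [h2] at h1
    simp [starFun] at h1
  exact strictMonoOn_starFun.injOn (key x hx) (key y hy) (hx.2.trans hy.2.symm)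

theorem cos_sin_approx_left : |Real.cos 3.995895 + 0.656744779107| ≤ 1e-9 ∧
    |Real.sin 3.995895 + 0.754112919340| ≤ 1e-9 := by
  -- With 13 terms the error is at most 2·4²⁶/26! < 1e-10.
  have h1 := abs_cos_sub_sum_le (x := 3.995895) (n := 13) (by norm_num [abs_of_pos])
  have h2 := abs_sin_sub_sum_le (x := 3.995895) (n := 13) (by norm_num [abs_of_pos])
  norm_num [Finset.sum_range_succ, Nat.factorial, abs_of_pos] at h1 h2
  norm_num
  rw [abs_le] at h1 h2 ⊢
  rw [abs_le]
  refine ⟨⟨?_, ?_⟩, ?_, ?_⟩ <;> linarith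

theorem cos_sin_approx_right : |Real.cos 3.995896 + 0.656744024994| ≤ 1e-9 ∧
    |Real.sin 3.995896 + 0.754113576085| ≤ 1e-9 := by
  have h1 := abs_cos_sub_sum_le (x := 3.995896) (n := 13) (by norm_num [abs_of_pos])
  have h2 := abs_sin_sub_sum_le (x := 3.995896) (n := 13) (by norm_num [abs_of_pos])
  norm_num [Finset.sum_range_succ, Nat.factorial, abs_of_pos] at h1 h2
  norm_num
  rw [abs_le] at h1 h2 ⊢
  rw [abs_le]
  refine ⟨⟨?_, ?_⟩, ?_, ?_⟩ <;> linarith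

theorem exists_isThetaStarRoot :
    ∃ t, IsThetaStarRoot t ∧ 3.995895 ≤ t ∧ t ≤ 3.995896 := by
  obtain ⟨h1, h2⟩ := cos_sin_approx_left
  obtain ⟨h3, h4⟩ := cos_sin_approx_right
  rw [abs_le] at h1 h2 h3 h4
  have hl : starFun 3.995895 ≤ 0 := by rw [starFun]; linarith
  have hr : 0 ≤ starFun 3.995896 := by rw [starFun]; linarith
  obtain ⟨t, ht, h⟩ := intermediate_value_Icc (by norm_num) continuous_starFun.continuousOn ⟨hl, hr⟩
  refine ⟨t, ⟨⟨?_, ?_⟩, h⟩, ht.1, ht.2⟩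
  · linarith [ht.1]
  · linarith [ht.2, Real.pi_gt_three]

/-- Sine is 1-Lipschitz: 1e-6 is the width of the interval and 1e-9 the error at its left end. -/
theorem abs_sin_add_le {t : ℝ} (h1 : 3.995895 ≤ t) (h2 : t ≤ 3.995896) :
    |Real.sin t + 0.754112919340| ≤ 1.001e-6 := by
  have h3 := cos_sin_approx_left.2
  have h4 := Real.abs_sin_sub_sin_le t 3.995895
  rw [abs_of_nonneg (by linarith : 0 ≤ t - 3.995895)] at h4
  rw [abs_le] at *
  constructor <;> linarith

/-- Half the derivative of `ratioSq l` is A A' + (B - l) B'; at θ₃* the first term vanishes and B' <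
0, so the critical l is B. -/
theorem critParam_eq_bFun {t : ℝ} (ht : IsThetaStarRoot t) : critParam t = bFun t := by
  have h0 := ht.1.1
  have h1 := eFun_pos h0
  rw [critParam, bFun, div_eq_div_iff (by positivity) (by positivity), nFun, eFun]
  linear_combination t ^ 3 * (3 * t ^ 2 + 6 * (Real.cos t - 1)) * ht.2
    - 36 * t ^ 3 * Real.sin_sq_add_cos_sq t

/-- The root equation eliminates the cosine, so a sine estimate suffices for the bounds. -/
theorem aFun_eq {t : ℝ} (ht : IsThetaStarRoot t) : aFun t = 2 * (t - Real.sin t) / t ^ 2 := by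
  have h0 := ht.1.1
  have h2 := ht.2
  rw [aFun]
  field_simp
  linarith

theorem bFun_bounds {t : ℝ} (h1 : 3.995895 ≤ t) (h2 : t ≤ 3.995896) :
    0.4466 ≤ bFun t ∧ bFun t < 0.4467 := by
  have h3 := abs_sin_add_le h1 h2
  have h4 : (3.995895 : ℝ) ^ 3 ≤ t ^ 3 := by gcongr
  have h5 : t ^ 3 ≤ (3.995896 : ℝ) ^ 3 := by gcongr
  have h6 : 0 < t ^ 3 := by positivity
  rw [abs_le] at h3
  rw [bFun, le_div_iff₀ h6, div_lt_iff₀ h6]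
  constructor <;> linarith

theorem aFun_bounds {t : ℝ} (ht : IsThetaStarRoot t) (h1 : 3.995895 ≤ t) (h2 : t ≤ 3.995896) :
    0.594971 ≤ aFun t ∧ aFun t < 0.594972 := by
  have h3 := abs_sin_add_le h1 h2
  have h4 : (3.995895 : ℝ) ^ 2 ≤ t ^ 2 := by gcongr
  have h5 : t ^ 2 ≤ (3.995896 : ℝ) ^ 2 := by gcongr
  have h6 : 0 < t ^ 2 := by positivity
  rw [abs_le] at h3
  rw [aFun_eq ht, le_div_iff₀ h6, div_lt_iff₀ h6]
  constructor <;> linarith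

/-! ### Properties of q₃ -/

/-- The characteristic function of the density `3 (1 - t)²` on `[0, 1]`; `expTaylorRatio 3 l x`
is its distance to `l`. -/
noncomputable def expRemainder (x : ℝ) : ℂ := ⟨bFun x, aFun x⟩

theorem norm_expRemainder_sub (l x : ℝ) : ‖expRemainder x - l‖ = Real.sqrt (ratioSq l x) := by
  rw [Complex.norm_def, Complex.normSq_apply, ratioSq]
  congr 1
  simp [expRemainder]
  ring

theorem expTaylorRatio_eq_norm {l x : ℝ} (hx : 0 < x) :
    expTaylorRatio 3 l x = ‖expRemainder x - l‖ := by
  rw [norm_expRemainder_sub, expTaylorRatio_eq_sqrt hx]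

/-- The triangle inequality through 3/8 gives finiteness for every l, and the sharp bound 1 - l when
l ≤ 3/8. -/
theorem norm_expRemainder_sub_le {x : ℝ} (l : ℝ) (hx : 0 < x) :
    ‖expRemainder x - l‖ ≤ 5 / 8 + |3 / 8 - l| := by
  have h1 : ‖expRemainder x - (3 / 8 : ℝ)‖ ≤ 5 / 8 := by
    rw [norm_expRemainder_sub]
    exact Real.sqrt_le_iff.2 ⟨by norm_num, ratioSq_three_eighths_le hx⟩
  have h2 := norm_sub_le_norm_sub_add_norm_sub (expRemainder x) ((3 / 8 : ℝ) : ℂ) (l : ℂ)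
  rw [← Complex.ofReal_sub, Complex.norm_real, Real.norm_eq_abs] at h2
  linarith

theorem bddAbove_expTaylorRatio (l : ℝ) : BddAbove (expTaylorRatio 3 l '' Ioi 0) := by
  refine ⟨5 / 8 + |3 / 8 - l|, ?_⟩
  rintro _ ⟨x, hx, rfl⟩
  rw [expTaylorRatio_eq_norm hx]
  exact norm_expRemainder_sub_le l hx

theorem norm_le_expTaylorQ {x : ℝ} (l : ℝ) (hx : 0 < x) :
    ‖expRemainder x - l‖ ≤ expTaylorQ 3 l :=
  le_csSup (bddAbove_expTaylorRatio l) ⟨x, hx, expTaylorRatio_eq_norm hx⟩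

theorem expTaylorQ_le {l M : ℝ} (h : ∀ x, 0 < x → ‖expRemainder x - l‖ ≤ M) :
    expTaylorQ 3 l ≤ M := by
  refine csSup_le (nonempty_Ioi.image _) ?_
  rintro _ ⟨x, hx, rfl⟩
  rw [expTaylorRatio_eq_norm hx]
  exact h x hx

theorem expTaylorQ_eq_one_sub {l : ℝ} (hl : l ≤ 3 / 8) : expTaylorQ 3 l = 1 - l := by
  refine le_antisymm (expTaylorQ_le fun x hx => ?_) ?_
  · have h := norm_expRemainder_sub_le l hx
    rw [abs_of_nonneg (sub_nonneg.2 hl)] at h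
    linarith
  -- The lower bound comes from x → 0+, where the real part of F - l tends to 1 - l.
  · refine le_of_tendsto (tendsto_bFun.sub_const l) ?_
    filter_upwards [self_mem_nhdsWithin] with x hx
    refine le_trans ?_ (norm_le_expTaylorQ l hx)
    refine le_trans (le_of_eq ?_) (Complex.re_le_norm _)
    simp [expRemainder]

theorem expTaylorQ_eq_of_forall_le {l t : ℝ} (ht : 0 < t)
    (h : ∀ x, 0 < x → ratioSq l x ≤ ratioSq l t) : expTaylorQ 3 l = ‖expRemainder t - l‖ := by
  refine le_antisymm (expTaylorQ_le fun x hx => ?_) (norm_le_expTaylorQ l ht)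
  rw [norm_expRemainder_sub, norm_expRemainder_sub]
  exact Real.sqrt_le_sqrt (h x hx)

theorem aFun_pos {x : ℝ} (hx : 0 < x) : 0 < aFun x := by
  have := Real.one_sub_sq_div_two_lt_cos hx.ne'
  exact div_pos (by linarith) (by positivity)

theorem aFun_le_norm (l x : ℝ) : aFun x ≤ ‖expRemainder x - l‖ := by
  refine le_trans (le_of_eq ?_) (Complex.im_le_norm _)
  simp [expRemainder]

theorem aFun_lt_norm {l x : ℝ} (hl : l ≠ bFun x) :
    aFun x < ‖expRemainder x - l‖ := by
  rw [norm_expRemainder_sub]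
  refine Real.lt_sqrt_of_sq_lt ?_
  have := sq_pos_of_ne_zero (sub_ne_zero.2 hl.symm)
  rw [ratioSq]
  linarith

theorem norm_bFun {x : ℝ} (hx : 0 < x) : ‖expRemainder x - bFun x‖ = aFun x := by
  rw [norm_expRemainder_sub, ratioSq, sub_self, zero_pow two_ne_zero, add_zero,
    Real.sqrt_sq (aFun_pos hx).le]

/-- The distance to F(x) has slope greater than -1 in l, because A(x) > 0 keeps F(x) off the real
axis. -/
theorem add_norm_lt {l m x : ℝ} (hx : 0 < x) (hlm : l < m) :
    l + ‖expRemainder x - l‖ < m + ‖expRemainder x - m‖ := by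
  have ha := aFun_pos hx
  have h : bFun x - m < Real.sqrt (ratioSq m x) := by
    refine Real.lt_sqrt_of_sq_lt ?_
    have := pow_pos ha 2
    rw [ratioSq]
    linarith
  have h2 : Real.sqrt (ratioSq m x) ^ 2 = aFun x ^ 2 + (bFun x - m) ^ 2 :=
    Real.sq_sqrt (by unfold ratioSq; positivity)
  have h3 := mul_pos (sub_pos.2 hlm) (sub_pos.2 h)
  rw [norm_expRemainder_sub, norm_expRemainder_sub, ← lt_sub_iff_add_lt',
    Real.sqrt_lt' (by linarith [Real.sqrt_nonneg (ratioSq m x)]), ratioSq]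
  linarith

theorem norm_sub_le_combo {l m s x t : ℝ} (ht0 : 0 ≤ t) (ht1 : t ≤ 1)
    (hm : m = (1 - t) * l + t * s) :
    ‖expRemainder x - m‖ ≤ (1 - t) * ‖expRemainder x - l‖ + t * ‖expRemainder x - s‖ := by
  have h : expRemainder x - m
      = ((1 - t : ℝ) : ℂ) * (expRemainder x - l) + (t : ℂ) * (expRemainder x - s) := by
    rw [hm]; push_cast; ring
  rw [h]
  refine (norm_add_le _ _).trans (le_of_eq ?_)
  rw [norm_mul, norm_mul, Complex.norm_real, Complex.norm_real, Real.norm_of_nonneg ht0,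
    Real.norm_of_nonneg (sub_nonneg.2 ht1)]

/-- A convex function decreases strictly before a strict minimum. -/
theorem strictAntiOn_expTaylorQ {s : ℝ} (h : ∀ l < s, expTaylorQ 3 s < expTaylorQ 3 l) :
    StrictAntiOn (expTaylorQ 3) (Iic s) := by
  intro l hl m hm hlm
  have hls : l < s := hlm.trans_le hm
  have hd : 0 < s - l := sub_pos.2 hls
  set t := (m - l) / (s - l) with ht
  have ht0 : 0 < t := div_pos (sub_pos.2 hlm) hd
  have ht1 : t ≤ 1 := (div_le_one hd).2 (sub_le_sub_right hm l)
  have hmt : m = (1 - t) * l + t * s := by rw [ht]; field_simp; ring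
  -- q₃ is convex, being a supremum of the convex functions |F(x) - l| of l.
  have hq : expTaylorQ 3 m ≤ (1 - t) * expTaylorQ 3 l + t * expTaylorQ 3 s := by
    refine expTaylorQ_le fun x hx => (norm_sub_le_combo ht0.le ht1 hmt).trans ?_
    have := sub_nonneg.2 ht1
    gcongr <;> exact norm_le_expTaylorQ _ hx
  have := mul_lt_mul_of_pos_left (h l hls) ht0
  linarith

theorem expTaylorQ_bFun {t : ℝ} (ht : IsThetaStarRoot t) (h0 : 0 ≤ bFun t)
    (h1 : bFun t ≤ 0.4467) : expTaylorQ 3 (bFun t) = aFun t := by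
  rw [expTaylorQ_eq_of_forall_le ht.1.1 fun x hx =>
    ratioSq_le_of_critParam_eq h0 h1 ht.1 (critParam_eq_bFun ht) hx, norm_bFun ht.1.1]

theorem six_mul_kappaThree {t : ℝ} (ht : 0 < t) (h : ∀ x, 0 < x → aFun x ≤ aFun t) :
    6 * kappaThree = aFun t := by
  have e : ∀ x : ℝ, (Real.cos x - 1 + x ^ 2 / 2) / x ^ 3 = aFun x / 6 := by
    intro x; rw [aFun]; ring
  have : kappaThree = aFun t / 6 := by
    refine IsGreatest.csSup_eq ⟨⟨t, ht, e t⟩, ?_⟩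
    rintro _ ⟨x, hx, rfl⟩
    change (Real.cos x - 1 + x ^ 2 / 2) / x ^ 3 ≤ _
    rw [e]
    have := h x hx
    linarith
  rw [this]
  ring

/-! ### Assembly -/

theorem lemma2 :
    ∃ (θs ls : ℝ) (θ : ℝ → ℝ),
      -- the number `θ₃*`
      (IsThetaStarRoot θs ∧ ∀ y : ℝ, IsThetaStarRoot y → y = θs) ∧
      (3.9958 ≤ θs ∧ θs < 3.9959) ∧
      -- the number `λ*`
      ls = 6 * ((θs - Real.sin θs) / θs ^ 3) ∧
      (0.4466 ≤ ls ∧ ls < 0.4467) ∧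
      -- the function `θ₃(λ)`
      (∀ l ∈ Set.Ioc (3 / 8 : ℝ) ls,
        IsThetaRoot l (θ l) ∧ ∀ y : ℝ, IsThetaRoot l y → y = θ l) ∧
      (∀ l ∈ Set.Icc (0 : ℝ) (3 / 8), θ l = 0) ∧
      θ ls = θs ∧
      -- the supremum that defines `q₃(λ)` is finite for every `λ ≥ 0`
      (∀ l : ℝ, 0 ≤ l → BddAbove (expTaylorRatio 3 l '' Set.Ioi 0)) ∧
      -- the values of `q₃`
      (∀ l ∈ Set.Icc (0 : ℝ) (3 / 8), expTaylorQ 3 l = 1 - l) ∧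
      (∀ l ∈ Set.Ioc (3 / 8 : ℝ) ls,
        IsMaxOn (expTaylorRatio 3 l) (Set.Ioi 0) (θ l) ∧
        expTaylorQ 3 l = 6 / (θ l) ^ 3 *
          Real.sqrt ((Real.cos (θ l) - 1 + (θ l) ^ 2 / 2) ^ 2
            + (Real.sin (θ l) - θ l + l * (θ l) ^ 3 / 6) ^ 2)) ∧
      -- monotonicity
      StrictMonoOn (fun l : ℝ => l + expTaylorQ 3 l) (Set.Ioc (3 / 8 : ℝ) ls) ∧
      StrictAntiOn (expTaylorQ 3) (Set.Icc 0 ls) ∧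
      -- the value at `3/8` and the minimum
      expTaylorQ 3 (3 / 8) = 5 / 8 ∧
      IsLeast (expTaylorQ 3 '' Set.Ici 0) (expTaylorQ 3 ls) ∧
      expTaylorQ 3 ls = 6 * kappaThree ∧
      (0.594971 ≤ 6 * kappaThree ∧ 6 * kappaThree < 0.594972) := by
  obtain ⟨θs, hs, hs1, hs2⟩ := exists_isThetaStarRoot
  have hs0 : 0 < θs := hs.1.1
  obtain ⟨hb1, hb2⟩ := bFun_bounds hs1 hs2
  obtain ⟨ha1, ha2⟩ := aFun_bounds hs hs1 hs2
  have hcrit := critParam_eq_bFun hs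
  have hq : expTaylorQ 3 (bFun θs) = aFun θs := expTaylorQ_bFun hs (by linarith) hb2.le
  -- A is the imaginary part of F - λ*, so q₃(λ*) = A(θ₃*) bounds A everywhere.
  have hκ : 6 * kappaThree = aFun θs := six_mul_kappaThree hs0 fun x hx =>
    (aFun_le_norm _ x).trans ((norm_le_expTaylorQ (bFun θs) hx).trans_eq hq)
  have huniq : ∀ l x y, IsThetaRoot l x → IsThetaRoot l y → y = x := by
    intro l x y hx hy
    rw [isThetaRoot_iff] at hx hy
    exact strictMonoOn_critParam.injOn hy.1 hx.1 (hy.2.trans hx.2.symm)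
  -- The default value 0 off (3/8, λ*] supplies the convention θ₃(l) = 0 for l ≤ 3/8.
  have hex : ∀ l, ∃ t, (l ∈ Ioc (3 / 8) (bFun θs) → IsThetaRoot l t) ∧
      (l ∉ Ioc (3 / 8) (bFun θs) → t = 0) := by
    intro l
    by_cases hl : l ∈ Ioc (3 / 8) (bFun θs)
    · obtain ⟨x, hx, h⟩ := exists_critParam_eq hl.1 hs.1 (hcrit ▸ hl.2)
      exact ⟨x, fun _ => isThetaRoot_iff.2 ⟨⟨hx.1, hx.2.trans_lt hs.1.2⟩, h⟩, fun h => (h hl).elim⟩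
    · exact ⟨0, fun h => (hl h).elim, fun _ => rfl⟩
  choose θ hθ hθ0 using hex
  have hmax : ∀ l ∈ Ioc (3 / 8) (bFun θs), 0 < θ l ∧ ∀ x, 0 < x → ratioSq l x ≤ ratioSq l (θ l) := by
    intro l hl
    obtain ⟨h1, h2⟩ := isThetaRoot_iff.1 (hθ l hl)
    exact ⟨h1.1, fun x hx => ratioSq_le_of_critParam_eq (by linarith [hl.1])
      (hl.2.trans hb2.le) h1 h2 hx⟩
  refine ⟨θs, bFun θs, θ, ⟨hs, fun y hy => hy.eq hs⟩, ⟨by linarith, by linarith⟩,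
    mul_div_assoc _ _ _, ⟨hb1, hb2⟩, fun l hl => ⟨hθ l hl, fun y => huniq l _ y (hθ l hl)⟩,
    fun l hl => hθ0 l fun h => h.1.not_ge hl.2, ?_, fun l _ => bddAbove_expTaylorRatio l,
    fun l hl => expTaylorQ_eq_one_sub hl.2, fun l hl => ?_, ?_, ?_, ?_, ?_, ?_, ?_⟩
  · have hmem : bFun θs ∈ Ioc (3 / 8) (bFun θs) := ⟨by linarith, le_rfl⟩
    exact huniq _ _ _ (isThetaRoot_iff.2 ⟨hs.1, hcrit⟩) (hθ _ hmem)
  · obtain ⟨h0, h⟩ := hmax l hl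
    refine ⟨fun x hx => ?_, ?_⟩
    · change expTaylorRatio 3 l x ≤ expTaylorRatio 3 l (θ l)
      rw [expTaylorRatio_eq_sqrt hx, expTaylorRatio_eq_sqrt h0]
      exact Real.sqrt_le_sqrt (h x hx)
    · rw [expTaylorQ_eq_of_forall_le h0 h, ← expTaylorRatio_eq_norm h0, expTaylorRatio_eq]
  · intro l hl m hm hlm
    obtain ⟨h0, h⟩ := hmax l hl
    -- Both parameters are compared at the maximizer for l: it attains q₃(l) and bounds q₃(m) from
    -- below.
    have h1 := add_norm_lt h0 hlm
    have h2 := norm_le_expTaylorQ m h0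
    change l + expTaylorQ 3 l < m + expTaylorQ 3 m
    rw [expTaylorQ_eq_of_forall_le h0 h]
    linarith
  · refine (strictAntiOn_expTaylorQ fun l hl => ?_).mono fun l hl => hl.2
    rw [hq]
    exact (aFun_lt_norm hl.ne).trans_le (norm_le_expTaylorQ l hs0)
  · rw [expTaylorQ_eq_one_sub le_rfl]
    norm_num
  · refine ⟨⟨bFun θs, by rw [mem_Ici]; linarith, rfl⟩, ?_⟩
    rintro _ ⟨l, -, rfl⟩
    rw [hq]
    exact (aFun_le_norm l θs).trans (norm_le_expTaylorQ l hs0)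
  · rw [hq, hκ]
  · rw [hκ]
    exact ⟨ha1, ha2⟩
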